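/- Let $V$ be a finite set and $r \ge 1$. A complete $r$-partite $r$-graph (a block) on $V$ is given by $r$ nonempty, pairwise disjoint subsets $V_1, \dots, V_r$ of $V$ (which need not exhaust $V$); its edges are all $r$-element sets consisting of precisely one vertex from each $V_i$. Let $f_r(n)$ be the minimum number of pairwise edge-disjoint complete $r$-partite $r$-graphs the union of whose edge sets is the edge set of the complete $r$-uniform hypergraph on $n$ vertices, that is, the set of all $r$-element subsets of an $n$-element vertex set. Then there is a constant $c_{125} < 1$ such that $$f_{125}(n) \le c_{125}\,(1+o(1))\binom{n}{62},$$ where the $o(1)$ term tends to $0$ as $n \to \infty$. -/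

import Mathlib

/-- The edge set of the complete `r`-partite `r`-graph with parts `P 0, …, P (r - 1)`: all sets of
vertices of these parts that contain precisely one vertex of each part. -/
def completePartiteEdges {V : Type*} [DecidableEq V] {r : ℕ} (P : Fin r → Finset V) :
    Finset (Finset V) :=
  (Finset.univ.biUnion P).powerset.filter fun e => ∀ i, (e ∩ P i).card = 1

/-- A block: (the edge set of) a complete `r`-partite `r`-graph whose parts are nonempty, pairwise
disjoint sets of vertices in `V`; the parts need not exhaust `V`. -/
def IsBlock {V : Type*} [DecidableEq V] (r : ℕ) (B : Finset (Finset V)) : Prop :=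
  ∃ P : Fin r → Finset V, (∀ i, (P i).Nonempty) ∧ (∀ i j, i ≠ j → Disjoint (P i) (P j)) ∧
    B = completePartiteEdges P

/-- The set `Γ` of complete `r`-partite `r`-graphs exactly covers the hypergraph `F`: its members
are edge-disjoint and the union of their edge sets is `F`. -/
def ExactlyCovers {V : Type*} [DecidableEq V] (r : ℕ) (Γ : Finset (Finset (Finset V)))
    (F : Finset (Finset V)) : Prop :=
  (∀ B ∈ Γ, IsBlock r B) ∧ (∀ B ∈ Γ, ∀ B' ∈ Γ, B ≠ B' → Disjoint B B') ∧ Γ.biUnion id = F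

/-- The minimum number `f_r(n)` of complete `r`-partite `r`-graphs that exactly cover the edge set
of the complete `r`-uniform hypergraph on `n` vertices. -/
noncomputable def minBlocks (r n : ℕ) : ℕ :=
  sInf {k : ℕ | ∃ Γ : Finset (Finset (Finset (Fin n))),
    ExactlyCovers r Γ (Finset.univ.powersetCard r) ∧ Γ.card = k}

/-- A single edge is a block. -/
theorem isBlock_singleton {V : Type*} [DecidableEq V] {r : ℕ} {e : Finset V} (he : e.card = r) :
    IsBlock r ({e} : Finset (Finset V)) := by
  let g : Fin r ≃ e := (Finset.equivFinOfCardEq he).symm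
  refine ⟨fun i => {(g i : V)}, fun i => Finset.singleton_nonempty _, ?_, ?_⟩
  · intro i j hij
    rw [Finset.disjoint_singleton]
    exact fun h => hij (g.injective (Subtype.ext h))
  · have hU : (Finset.univ : Finset (Fin r)).biUnion (fun i => {(g i : V)}) = e := by
      ext v
      simp only [Finset.mem_biUnion, Finset.mem_univ, true_and, Finset.mem_singleton]
      constructor
      · rintro ⟨i, rfl⟩
        exact (g i).2
      · intro hv
        exact ⟨g.symm ⟨v, hv⟩, by simp⟩
    ext s
    simp only [completePartiteEdges, hU, Finset.mem_singleton, Finset.mem_filter,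
      Finset.mem_powerset]
    constructor
    · rintro rfl
      refine ⟨subset_rfl, fun i => ?_⟩
      rw [Finset.inter_singleton_of_mem (g i).2, Finset.card_singleton]
    · rintro ⟨hs, h⟩
      refine subset_antisymm hs fun v hv => ?_
      by_contra hvs
      have := h (g.symm ⟨v, hv⟩)
      simp [Finset.inter_singleton_of_notMem hvs] at this

/-- The minimum that defines `minBlocks r n` is attained. -/
theorem exists_exactlyCovers_card_eq_minBlocks (r n : ℕ) :
    ∃ Γ : Finset (Finset (Finset (Fin n))),
      ExactlyCovers r Γ (Finset.univ.powersetCard r) ∧ Γ.card = minBlocks r n := by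
  refine Nat.sInf_mem (s := {k : ℕ | ∃ Γ : Finset (Finset (Finset (Fin n))),
    ExactlyCovers r Γ (Finset.univ.powersetCard r) ∧ Γ.card = k}) ⟨_,
      (Finset.univ.powersetCard r).image fun e => {e}, ⟨?_, ?_, ?_⟩, rfl⟩
  · intro B hB
    obtain ⟨e, he, rfl⟩ := Finset.mem_image.1 hB
    exact isBlock_singleton (Finset.mem_powersetCard.1 he).2
  · intro B hB B' hB' hne
    obtain ⟨e, -, rfl⟩ := Finset.mem_image.1 hB
    obtain ⟨e', -, rfl⟩ := Finset.mem_image.1 hB'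
    rw [Finset.disjoint_singleton]
    rintro rfl
    exact hne rfl
  · ext s
    simp [Finset.mem_biUnion]

/-! The gain comes from one finite fact: $E(K_4)\times E(K_6)$ splits into 14 products of two
complete bipartite graphs (`card_separates_eq_one`), whereas multiplying optimal decompositions of
the two factors gives $3\cdot 5=15$. Peeling vertices off in groups of 3 and 5 writes a complete
graph as an edge-disjoint union of complete 4-partite, respectively 6-partite, graphs. Hence the
product of two complete graphs on $s$ vertices needs only about $\frac{14}{15}s^2$ blocks
(`hasCover_pairs_sups_pairs`) instead of about $s^2$.

For uniformity $2d$, partition the vertices into $m$ parts of size at most $s\approx n/m$ and sort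
the edges by how many vertices they have in each part. If these numbers are all 0 or 2, the edges
form a product of $d$ complete graphs, and pairing up the factors gives $(14/15)^{\lfloor
d/2\rfloor}s^d$ blocks to leading order. The other even types cost at most $s^d$ each but are a
vanishing proportion of the even types as $m\to\infty$; a type with an odd entry costs only
$s^{d-1}$. So about $(14/15)^{\lfloor d/2\rfloor}n^d/d!$ blocks suffice
(`eventually_exists_hasCover_powersetCard`).

For uniformity 125, halve the vertex set. An edge meets the halves in $a$ and $125-a$ vertices,
exactly one of which is even; the even side gets the improved cover, the odd side the standard one
of `hasCover_powersetCard`. Each binomial $\binom{62}{j}$ then occurs for two values of $a$, so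
without savings the total would be twice $\binom{n}{62}$. The saving on the even side therefore has
to beat a factor 2 on average, and at 125 it does: the weighted sum is below $0.92\cdot 2^{62}$
(`sum_choose_mul_evenDensity_lt`). -/

open scoped FinsetFamily
open Filter Topology

/-- `F` splits into at most `k` blocks. -/
def HasCover {V : Type*} [DecidableEq V] (r : ℕ) (F : Finset (Finset V)) (k : ℕ) : Prop :=
  ∃ Γ, ExactlyCovers r Γ F ∧ Γ.card ≤ k

/-! ### Covers by blocks: disjoint unions and products -/

section Cover

variable {V : Type*} [DecidableEq V]

theorem HasCover.mono {r k l : ℕ} {F : Finset (Finset V)} (h : HasCover r F k) (hkl : k ≤ l) :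
    HasCover r F l := by
  obtain ⟨Γ, hΓ, hc⟩ := h
  exact ⟨Γ, hΓ, hc.trans hkl⟩

theorem mem_completePartiteEdges {r : ℕ} {P : Fin r → Finset V}
    (hP : ∀ i j, i ≠ j → Disjoint (P i) (P j)) {e : Finset V} :
    e ∈ completePartiteEdges P ↔ ∃ x : Fin r → V, (∀ i, x i ∈ P i) ∧ e = Finset.univ.image x := by
  simp only [completePartiteEdges, Finset.mem_filter, Finset.mem_powerset]
  constructor
  · rintro ⟨hs, h⟩
    choose x hx using fun i => Finset.card_eq_one.1 (h i)
    have hx' : ∀ i, x i ∈ e ∩ P i := fun i => by rw [hx i]; exact Finset.mem_singleton_self _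
    refine ⟨x, fun i => (Finset.mem_inter.1 (hx' i)).2, ?_⟩
    ext v
    simp only [Finset.mem_image, Finset.mem_univ, true_and]
    constructor
    · intro hv
      obtain ⟨i, -, hi⟩ := Finset.mem_biUnion.1 (hs hv)
      have : v ∈ e ∩ P i := Finset.mem_inter.2 ⟨hv, hi⟩
      rw [hx i, Finset.mem_singleton] at this
      exact ⟨i, this.symm⟩
    · rintro ⟨i, rfl⟩
      exact (Finset.mem_inter.1 (hx' i)).1
  · rintro ⟨x, hx, rfl⟩
    refine ⟨?_, fun i => ?_⟩
    · intro v hv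
      obtain ⟨i, -, rfl⟩ := Finset.mem_image.1 hv
      exact Finset.mem_biUnion.2 ⟨i, Finset.mem_univ _, hx i⟩
    · rw [Finset.card_eq_one]
      refine ⟨x i, ?_⟩
      ext v
      simp only [Finset.mem_inter, Finset.mem_image, Finset.mem_univ, true_and,
        Finset.mem_singleton]
      constructor
      · rintro ⟨⟨j, rfl⟩, hj⟩
        by_contra hne
        exact Finset.disjoint_left.1 (hP j i (by rintro rfl; exact hne rfl)) (hx j) hj
      · rintro rfl
        exact ⟨⟨i, rfl⟩, hx i⟩

theorem HasCover.empty (r k : ℕ) : HasCover r (∅ : Finset (Finset V)) k :=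
  ⟨∅, ⟨by simp, by simp, by simp⟩, by simp⟩

/-- Empty parts are harmless: there are then no edges, and no block is needed. This is why
`HasCover` asks for at most `k` blocks. -/
theorem hasCover_completePartiteEdges {r : ℕ} {P : Fin r → Finset V}
    (hP : ∀ i j, i ≠ j → Disjoint (P i) (P j)) : HasCover r (completePartiteEdges P) 1 := by
  by_cases hne : ∀ i, (P i).Nonempty
  · refine ⟨{completePartiteEdges P}, ⟨?_, ?_, by simp⟩, by simp⟩
    · intro B hB
      rw [Finset.mem_singleton.1 hB]
      exact ⟨P, hne, hP, rfl⟩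
    · intro B hB B' hB' h
      exact absurd ((Finset.mem_singleton.1 hB).trans (Finset.mem_singleton.1 hB').symm) h
  · have : completePartiteEdges P = ∅ := by
      push Not at hne
      obtain ⟨i, hi⟩ := hne
      refine Finset.eq_empty_of_forall_notMem fun e he => ?_
      obtain ⟨x, hx, -⟩ := (mem_completePartiteEdges hP).1 he
      simpa [hi] using hx i
    rw [this]
    exact HasCover.empty r 1

theorem HasCover.biUnion {ι : Type*} {r : ℕ} {s : Finset ι}
    {F : ι → Finset (Finset V)} {k : ι → ℕ}
    (hF : ∀ i ∈ s, ∀ j ∈ s, i ≠ j → Disjoint (F i) (F j))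
    (h : ∀ i ∈ s, HasCover r (F i) (k i)) : HasCover r (s.biUnion F) (∑ i ∈ s, k i) := by
  classical
  choose! Γ hΓ hc using h
  refine ⟨s.biUnion Γ, ⟨?_, ?_, ?_⟩, Finset.card_biUnion_le.trans (Finset.sum_le_sum hc)⟩
  · intro B hB
    obtain ⟨i, hi, hB⟩ := Finset.mem_biUnion.1 hB
    exact (hΓ i hi).1 B hB
  · intro B hB B' hB' hne
    obtain ⟨i, hi, hB⟩ := Finset.mem_biUnion.1 hB
    obtain ⟨j, hj, hB'⟩ := Finset.mem_biUnion.1 hB'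
    by_cases hij : i = j
    · subst hij
      exact (hΓ i hi).2.1 B hB B' hB' hne
    · refine Finset.disjoint_of_subset_left ?_ (Finset.disjoint_of_subset_right ?_
        (hF i hi j hj hij))
      · rw [← (hΓ i hi).2.2]
        exact Finset.subset_biUnion_of_mem id hB
      · rw [← (hΓ j hj).2.2]
        exact Finset.subset_biUnion_of_mem id hB'
  · rw [Finset.biUnion_biUnion]
    exact Finset.biUnion_congr rfl fun i hi => (hΓ i hi).2.2

theorem HasCover.union {r k l : ℕ} {F G : Finset (Finset V)} (hFG : Disjoint F G)
    (hF : HasCover r F k) (hG : HasCover r G l) : HasCover r (F ∪ G) (k + l) := by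
  have := HasCover.biUnion (r := r) (s := Finset.univ) (F := fun b : Bool => if b then F else G)
    (k := fun b => if b then k else l) (by
      rintro (_ | _) - (_ | _) - h <;> simp_all [disjoint_comm]) (by
      rintro (_ | _) - <;> simp_all)
  simpa using this

theorem hasCover_singleton_empty : HasCover 0 ({∅} : Finset (Finset V)) 1 := by
  refine ⟨{{∅}}, ⟨?_, ?_, by simp⟩, by simp⟩
  · intro B hB
    rw [Finset.mem_singleton.1 hB]
    exact isBlock_singleton rfl
  · intro B hB B' hB' h
    exact absurd ((Finset.mem_singleton.1 hB).trans (Finset.mem_singleton.1 hB').symm) h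

theorem union_inj_of_disjoint {A B a a' b b' : Finset V} (hAB : Disjoint A B) (ha : a ⊆ A)
    (ha' : a' ⊆ A) (hb : b ⊆ B) (hb' : b' ⊆ B) (h : a ∪ b = a' ∪ b') : a = a' ∧ b = b' := by
  have key : ∀ {a b : Finset V}, a ⊆ A → b ⊆ B → (a ∪ b) ∩ A = a ∧ (a ∪ b) ∩ B = b := by
    intro a b ha hb
    rw [Finset.union_inter_distrib_right, Finset.union_inter_distrib_right,
      Finset.inter_eq_left.2 ha, Finset.inter_eq_left.2 hb,
      Finset.disjoint_iff_inter_eq_empty.1 (hAB.symm.mono_left hb),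
      Finset.disjoint_iff_inter_eq_empty.1 (hAB.mono_left ha)]
    simp
  exact ⟨by rw [← (key ha hb).1, h, (key ha' hb').1], by rw [← (key ha hb).2, h, (key ha' hb').2]⟩

theorem disjoint_sups_left {A B : Finset V} (hAB : Disjoint A B) {F F' G G' : Finset (Finset V)}
    (hF : F ⊆ A.powerset) (hF' : F' ⊆ A.powerset) (hG : G ⊆ B.powerset) (hG' : G' ⊆ B.powerset)
    (h : Disjoint F F') : Disjoint (F ⊻ G) (F' ⊻ G') := by
  rw [Finset.disjoint_left]
  intro e he he'
  obtain ⟨a, ha, b, hb, rfl⟩ := Finset.mem_sups.1 he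
  obtain ⟨a', ha', b', hb', hab⟩ := Finset.mem_sups.1 he'
  have := (union_inj_of_disjoint hAB (Finset.mem_powerset.1 (hF' ha'))
    (Finset.mem_powerset.1 (hF ha)) (Finset.mem_powerset.1 (hG' hb'))
    (Finset.mem_powerset.1 (hG hb)) hab).1
  exact Finset.disjoint_left.1 h ha (this ▸ ha')

theorem disjoint_sups_right {A B : Finset V} (hAB : Disjoint A B)
    {F F' G G' : Finset (Finset V)}
    (hF : F ⊆ A.powerset) (hF' : F' ⊆ A.powerset) (hG : G ⊆ B.powerset) (hG' : G' ⊆ B.powerset)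
    (h : Disjoint G G') : Disjoint (F ⊻ G) (F' ⊻ G') := by
  rw [Finset.sups_comm F, Finset.sups_comm F']
  exact disjoint_sups_left hAB.symm hG hG' hF hF' h

/-- As no part is empty, every vertex of a part extends to an edge. -/
theorem part_subset_of_completePartiteEdges_subset {r : ℕ} {P : Fin r → Finset V} {A : Finset V}
    (hne : ∀ i, (P i).Nonempty) (hP : ∀ i j, i ≠ j → Disjoint (P i) (P j))
    (h : completePartiteEdges P ⊆ A.powerset) (i : Fin r) : P i ⊆ A := by
  intro v hv
  choose x hx using hne
  have he : Finset.univ.image (Function.update x i v) ∈ completePartiteEdges P :=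
    (mem_completePartiteEdges hP).2 ⟨_, fun j => by
      by_cases hj : j = i
      · subst hj; simpa using hv
      · simpa [hj] using hx j, rfl⟩
  exact Finset.mem_powerset.1 (h he) (Finset.mem_image.2 ⟨i, Finset.mem_univ _, by simp⟩)

/-- Concatenating the two families of parts gives the parts of the product. -/
theorem IsBlock.sups {r s : ℕ} {A B : Finset V} (hAB : Disjoint A B) {F G : Finset (Finset V)}
    (hF : F ⊆ A.powerset) (hG : G ⊆ B.powerset) (hbF : IsBlock r F) (hbG : IsBlock s G) :
    IsBlock (r + s) (F ⊻ G) := by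
  obtain ⟨P, hPne, hP, rfl⟩ := hbF
  obtain ⟨Q, hQne, hQ, rfl⟩ := hbG
  have hPA := part_subset_of_completePartiteEdges_subset hPne hP hF
  have hQB := part_subset_of_completePartiteEdges_subset hQne hQ hG
  have hdis : ∀ i j, i ≠ j → Disjoint (Fin.append P Q i) (Fin.append P Q j) := by
    intro i j
    refine Fin.addCases (fun i => ?_) (fun i => ?_) i <;>
      refine Fin.addCases (fun j => ?_) (fun j => ?_) j <;> intro hij <;>
      simp only [Fin.append_left, Fin.append_right]
    · exact hP i j (by rintro rfl; exact hij rfl)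
    · exact hAB.mono (hPA i) (hQB j)
    · exact hAB.symm.mono (hQB i) (hPA j)
    · exact hQ i j (by rintro rfl; exact hij rfl)
  refine ⟨Fin.append P Q, ?_, hdis, ?_⟩
  · intro i
    refine Fin.addCases (fun i => ?_) (fun i => ?_) i
    · simpa using hPne i
    · simpa using hQne i
  · have himage : ∀ (x : Fin r → V) (y : Fin s → V), Finset.univ.image (Fin.append x y) =
        Finset.univ.image x ∪ Finset.univ.image y := by
      intro x y
      ext v
      simp only [Finset.mem_image, Finset.mem_union, Finset.mem_univ, true_and]
      constructor
      · rintro ⟨i, rfl⟩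
        refine Fin.addCases (fun i => ?_) (fun i => ?_) i
        · exact Or.inl ⟨i, by simp⟩
        · exact Or.inr ⟨i, by simp⟩
      · rintro (⟨i, rfl⟩ | ⟨i, rfl⟩)
        · exact ⟨Fin.castAdd s i, by simp⟩
        · exact ⟨Fin.natAdd r i, by simp⟩
    ext e
    rw [Finset.mem_sups, mem_completePartiteEdges hdis]
    constructor
    · rintro ⟨a, ha, b, hb, rfl⟩
      obtain ⟨x, hx, rfl⟩ := (mem_completePartiteEdges hP).1 ha
      obtain ⟨y, hy, rfl⟩ := (mem_completePartiteEdges hQ).1 hb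
      refine ⟨Fin.append x y, fun i => ?_, (himage x y).symm⟩
      refine Fin.addCases (fun i => ?_) (fun i => ?_) i
      · simpa using hx i
      · simpa using hy i
    · rintro ⟨z, hz, rfl⟩
      refine ⟨_, (mem_completePartiteEdges hP).2 ⟨fun i => z (Fin.castAdd s i), fun i => ?_, rfl⟩,
        _, (mem_completePartiteEdges hQ).2 ⟨fun i => z (Fin.natAdd r i), fun i => ?_, rfl⟩, ?_⟩
      · simpa using hz (Fin.castAdd s i)
      · simpa using hz (Fin.natAdd r i)
      · rw [Finset.sup_eq_union, ← himage, Fin.append_castAdd_natAdd]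

theorem HasCover.sups {r s k l : ℕ} {A B : Finset V} (hAB : Disjoint A B)
    {F G : Finset (Finset V)} (hF : F ⊆ A.powerset) (hG : G ⊆ B.powerset)
    (hcF : HasCover r F k) (hcG : HasCover s G l) : HasCover (r + s) (F ⊻ G) (k * l) := by
  obtain ⟨Γ, ⟨hΓb, hΓd, rfl⟩, hk⟩ := hcF
  obtain ⟨Δ, ⟨hΔb, hΔd, rfl⟩, hl⟩ := hcG
  have hΓA : ∀ B ∈ Γ, B ⊆ A.powerset := fun B hB =>
    (Finset.subset_biUnion_of_mem id hB).trans hF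
  have hΔB : ∀ C ∈ Δ, C ⊆ B.powerset := fun C hC =>
    (Finset.subset_biUnion_of_mem id hC).trans hG
  refine ⟨Finset.image₂ (· ⊻ ·) Γ Δ, ⟨?_, ?_, ?_⟩,
    (Finset.card_image₂_le _ _ _).trans (Nat.mul_le_mul hk hl)⟩
  · intro X hX
    obtain ⟨B, hB, C, hC, rfl⟩ := Finset.mem_image₂.1 hX
    exact (hΓb B hB).sups hAB (hΓA B hB) (hΔB C hC) (hΔb C hC)
  · intro X hX X' hX' hne
    obtain ⟨B, hB, C, hC, rfl⟩ := Finset.mem_image₂.1 hX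
    obtain ⟨B', hB', C', hC', rfl⟩ := Finset.mem_image₂.1 hX'
    by_cases hBB : B = B'
    · have hCC : C ≠ C' := by
        rintro rfl
        exact hne (by rw [hBB])
      exact disjoint_sups_right hAB (hΓA B hB) (hΓA B' hB') (hΔB C hC) (hΔB C' hC')
        (hΔd C hC C' hC' hCC)
    · exact disjoint_sups_left hAB (hΓA B hB) (hΓA B' hB') (hΔB C hC) (hΔB C' hC')
        (hΓd B hB B' hB' hBB)
  · ext e
    simp only [Finset.mem_biUnion, Finset.mem_image₂, Finset.mem_sups, id]
    constructor
    · rintro ⟨_, ⟨B, hB, C, hC, rfl⟩, he⟩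
      obtain ⟨a, ha, b, hb, rfl⟩ := Finset.mem_sups.1 he
      exact ⟨a, ⟨B, hB, ha⟩, b, ⟨C, hC, hb⟩, rfl⟩
    · rintro ⟨a, ⟨B, hB, ha⟩, b, ⟨C, hC, hb⟩, rfl⟩
      exact ⟨_, ⟨B, hB, C, hC, rfl⟩, Finset.mem_sups.2 ⟨a, ha, b, hb, rfl⟩⟩

theorem HasCover.minBlocks_le {r n k : ℕ}
    (h : HasCover r ((Finset.univ : Finset (Fin n)).powersetCard r) k) : minBlocks r n ≤ k := by
  obtain ⟨Γ, hΓ, hc⟩ := h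
  exact (Nat.sInf_le (m := Γ.card) ⟨Γ, hΓ, rfl⟩ : minBlocks r n ≤ Γ.card).trans hc

end Cover

/-! ### Fourteen products of bicliques for $E(K_4)\times E(K_6)$ -/

/-- The two ends of an edge lie on opposite sides (`1` and `2`) of a complete bipartite graph. -/
abbrev Separates (x y : Fin 3) : Prop := (x = 1 ∧ y = 2) ∨ (x = 2 ∧ y = 1)

/-- First factors of a decomposition of `E(K₄) × E(K₆)` into products of complete bipartite
graphs. -/
def fourSides : Fin 14 → Fin 4 → Fin 3 :=
  ![![1, 1, 2, 2], ![1, 1, 2, 2], ![1, 2, 1, 2], ![1, 2, 1, 2], ![1, 2, 2, 1], ![1, 2, 2, 1],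
    ![0, 0, 1, 2], ![0, 1, 0, 2], ![0, 1, 0, 2], ![0, 1, 2, 0], ![1, 0, 0, 2], ![1, 0, 2, 0],
    ![1, 0, 2, 0], ![1, 2, 0, 0]]

/-- Second factors of a decomposition of `E(K₄) × E(K₆)` into products of complete bipartite
graphs. -/
def sixSides : Fin 14 → Fin 6 → Fin 3 :=
  ![![0, 0, 1, 0, 1, 2], ![0, 1, 2, 2, 0, 0], ![1, 0, 2, 0, 2, 2], ![0, 0, 1, 2, 2, 0],
    ![1, 0, 0, 2, 1, 0], ![1, 2, 0, 0, 0, 1], ![0, 1, 2, 2, 2, 1], ![1, 1, 1, 0, 2, 0],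
    ![1, 0, 2, 1, 0, 2], ![1, 2, 0, 2, 1, 1], ![1, 2, 0, 2, 1, 1], ![1, 0, 2, 1, 0, 2],
    ![1, 1, 1, 0, 2, 0], ![0, 1, 2, 2, 2, 1]]

-- A finite check over the $6\cdot 15$ pairs of edges. Colour 0 marks vertices outside the biclique.
-- The first factors are the three balanced splits of $K_4$, twice each, and eight single edges; for
-- each edge of $K_4$, the second factors of the products that use it partition $E(K_6)$.
set_option maxRecDepth 100000 in
set_option maxHeartbeats 4000000 in
theorem card_separates_eq_one : ∀ i j : Fin 4, i < j → ∀ p q : Fin 6, p < q →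
    (Finset.univ.filter fun k => Separates (fourSides k i) (fourSides k j) ∧
      Separates (sixSides k p) (sixSides k q)).card = 1 := by
  decide +kernel

theorem separates_comm {x y : Fin 3} : Separates x y ↔ Separates y x := by
  unfold Separates; tauto

theorem existsUnique_separates {i j : Fin 4} (hij : i ≠ j) {p q : Fin 6} (hpq : p ≠ q) :
    ∃! k, Separates (fourSides k i) (fourSides k j) ∧ Separates (sixSides k p) (sixSides k q) := by
  wlog hij' : i < j generalizing i j
  · simpa only [separates_comm] using this hij.symm (lt_of_le_of_ne (not_lt.1 hij') hij.symm)
  wlog hpq' : p < q generalizing p q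
  · have := this hpq.symm (lt_of_le_of_ne (not_lt.1 hpq') hpq.symm)
    simpa only [separates_comm (x := sixSides _ q)] using this
  obtain ⟨k, hk⟩ := Finset.card_eq_one.1 (card_separates_eq_one i j hij' p q hpq')
  have hk' : ∀ l, l ∈ Finset.univ.filter (fun k => Separates (fourSides k i) (fourSides k j) ∧
      Separates (sixSides k p) (sixSides k q)) ↔ l = k := fun l => by
    rw [hk, Finset.mem_singleton]
  simp only [Finset.mem_filter, Finset.mem_univ, true_and] at hk'
  exact ⟨k, (hk' k).2 rfl, fun l hl => (hk' l).1 hl⟩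

theorem biclique_parts_disjoint {V : Type*} (A : Finset V) (c : V → Fin 3)
    (i j : Fin 2) (hij : i ≠ j) :
    Disjoint ((![A.filter (c · = 1), A.filter (c · = 2)] : Fin 2 → Finset V) i)
      ((![A.filter (c · = 1), A.filter (c · = 2)] : Fin 2 → Finset V) j) := by
  have h : Disjoint (A.filter (c · = 1)) (A.filter (c · = 2)) := by
    rw [Finset.disjoint_left]
    intro x hx hx'
    rw [Finset.mem_filter] at hx hx'
    rw [hx.2] at hx'
    exact absurd hx'.2 (by decide)
  fin_cases i <;> fin_cases j
  · exact absurd rfl hij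
  · exact h
  · exact h.symm
  · exact absurd rfl hij

theorem powersetCard_subset_powerset {V : Type*} (r : ℕ) (A : Finset V) :
    A.powersetCard r ⊆ A.powerset :=
  fun _ he => Finset.mem_powerset.2 (Finset.mem_powersetCard.1 he).1

/-! ### Products of two complete graphs -/

section Pairs

variable {V : Type*} [DecidableEq V]

/-- The complete bipartite graph between the vertices of `A` of colours `1` and `2`. -/
def biclique (A : Finset V) (c : V → Fin 3) : Finset (Finset V) :=
  completePartiteEdges ![A.filter (c · = 1), A.filter (c · = 2)]

theorem hasCover_biclique (A : Finset V) (c : V → Fin 3) : HasCover 2 (biclique A c) 1 :=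
  hasCover_completePartiteEdges (biclique_parts_disjoint A c)

theorem mem_biclique {A : Finset V} {c : V → Fin 3} {e : Finset V} :
    e ∈ biclique A c ↔ ∃ x ∈ A, ∃ y ∈ A, c x = 1 ∧ c y = 2 ∧ e = {x, y} := by
  rw [biclique, mem_completePartiteEdges (biclique_parts_disjoint A c)]
  constructor
  · rintro ⟨x, hx, rfl⟩
    have h0 := hx 0
    have h1 := hx 1
    simp only [Matrix.cons_val_zero, Matrix.cons_val_one, Finset.mem_filter] at h0 h1
    refine ⟨x 0, h0.1, x 1, h1.1, h0.2, h1.2, ?_⟩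
    ext v
    simp [Fin.exists_fin_two, eq_comm]
  · rintro ⟨x, hx, y, hy, hcx, hcy, rfl⟩
    refine ⟨![x, y], ?_, ?_⟩
    · intro i
      fin_cases i <;> simp [*]
    · ext v
      simp [Fin.exists_fin_two, eq_comm]

theorem pair_mem_biclique {A : Finset V} {c : V → Fin 3} {x y : V} :
    ({x, y} : Finset V) ∈ biclique A c ↔ x ∈ A ∧ y ∈ A ∧ Separates (c x) (c y) := by
  rw [mem_biclique]
  constructor
  · rintro ⟨x', hx', y', hy', h1, h2, h⟩
    have h' : ({x, y} : Set V) = {x', y'} := by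
      simpa using congrArg (fun s : Finset V => (s : Set V)) h
    rcases Set.pair_eq_pair_iff.1 h' with ⟨rfl, rfl⟩ | ⟨rfl, rfl⟩
    · exact ⟨hx', hy', Or.inl ⟨h1, h2⟩⟩
    · exact ⟨hy', hx', Or.inr ⟨h2, h1⟩⟩
  · rintro ⟨hx, hy, ⟨h1, h2⟩ | ⟨h1, h2⟩⟩
    · exact ⟨x, hx, y, hy, h1, h2, rfl⟩
    · exact ⟨y, hy, x, hx, h2, h1, Finset.pair_comm x y⟩

theorem biclique_subset_powerset (A : Finset V) (c : V → Fin 3) :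
    biclique A c ⊆ A.powerset := by
  intro e he
  obtain ⟨x, hx, y, hy, -, -, rfl⟩ := mem_biclique.1 he
  simp [Finset.insert_subset_iff, hx, hy]

/-- The pairs of vertices of `A` of distinct colours. -/
def rainbowPairs {κ : Type*} [DecidableEq κ] (A : Finset V) (φ : V → κ) : Finset (Finset V) :=
  (A.powersetCard 2).filter fun e => ∀ x ∈ e, ∀ y ∈ e, φ x = φ y → x = y

theorem mem_rainbowPairs {κ : Type*} [DecidableEq κ] {A : Finset V} {φ : V → κ} {e : Finset V} :
    e ∈ rainbowPairs A φ ↔ ∃ x ∈ A, ∃ y ∈ A, φ x ≠ φ y ∧ e = {x, y} := by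
  rw [rainbowPairs, Finset.mem_filter, Finset.mem_powersetCard, Finset.card_eq_two]
  constructor
  · rintro ⟨⟨hs, x, y, hxy, rfl⟩, h⟩
    refine ⟨x, hs (by simp), y, hs (by simp), fun hφ => hxy (h x (by simp) y (by simp) hφ), rfl⟩
  · rintro ⟨x, hx, y, hy, hφ, rfl⟩
    refine ⟨⟨by simp [Finset.insert_subset_iff, hx, hy], x, y, by rintro rfl; exact hφ rfl, rfl⟩,
      ?_⟩
    intro u hu v hv huv
    simp only [Finset.mem_insert, Finset.mem_singleton] at hu hv
    rcases hu with rfl | rfl <;> rcases hv with rfl | rfl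
    · rfl
    · exact absurd huv hφ
    · exact absurd huv.symm hφ
    · rfl

theorem rainbowPairs_subset_powerset {κ : Type*} [DecidableEq κ] (A : Finset V) (φ : V → κ) :
    rainbowPairs A φ ⊆ A.powerset := fun _ he =>
  Finset.mem_powerset.2 (Finset.mem_powersetCard.1 (Finset.mem_filter.1 he).1).1

/-- The 14 products are blown up along the colourings: replacing vertices by colour classes keeps
bicliques bicliques. -/
theorem rainbowPairs_sups_eq {A B : Finset V} (φ : V → Fin 4) (ψ : V → Fin 6) :
    rainbowPairs A φ ⊻ rainbowPairs B ψ = (Finset.univ : Finset (Fin 14)).biUnion fun k =>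
      biclique A (fun v => fourSides k (φ v)) ⊻ biclique B (fun v => sixSides k (ψ v)) := by
  have key : ∀ {x y : Fin 3}, Separates x y → x ≠ y := by decide
  ext e
  simp only [Finset.mem_biUnion, Finset.mem_univ, true_and, Finset.mem_sups]
  constructor
  · rintro ⟨a, ha, b, hb, rfl⟩
    obtain ⟨x, hx, y, hy, hxy, rfl⟩ := mem_rainbowPairs.1 ha
    obtain ⟨z, hz, w, hw, hzw, rfl⟩ := mem_rainbowPairs.1 hb
    obtain ⟨k, ⟨h1, h2⟩, -⟩ := existsUnique_separates hxy hzw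
    exact ⟨k, _, pair_mem_biclique.2 ⟨hx, hy, h1⟩, _, pair_mem_biclique.2 ⟨hz, hw, h2⟩, rfl⟩
  · rintro ⟨k, a, ha, b, hb, rfl⟩
    obtain ⟨x, hx, y, hy, h1, h2, rfl⟩ := mem_biclique.1 ha
    obtain ⟨z, hz, w, hw, h3, h4, rfl⟩ := mem_biclique.1 hb
    refine ⟨_, mem_rainbowPairs.2 ⟨x, hx, y, hy, ?_, rfl⟩, _,
      mem_rainbowPairs.2 ⟨z, hz, w, hw, ?_, rfl⟩, rfl⟩
    · intro h
      rw [h, h2] at h1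
      exact absurd h1 (by decide)
    · intro h
      rw [h, h4] at h3
      exact absurd h3 (by decide)

theorem hasCover_rainbowPairs_sups {A B : Finset V} (hAB : Disjoint A B) (φ : V → Fin 4)
    (ψ : V → Fin 6) : HasCover 4 (rainbowPairs A φ ⊻ rainbowPairs B ψ) 14 := by
  have h := HasCover.biUnion (r := 4) (s := (Finset.univ : Finset (Fin 14))) (k := fun _ => 1)
    (F := fun k => biclique A (fun v => fourSides k (φ v)) ⊻
      biclique B (fun v => sixSides k (ψ v))) ?_ ?_
  · rw [rainbowPairs_sups_eq]
    simpa using h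
  · rintro k - l - hkl
    rw [Finset.disjoint_left]
    intro e he he'
    obtain ⟨a, ha, b, hb, rfl⟩ := Finset.mem_sups.1 he
    obtain ⟨a', ha', b', hb', hab⟩ := Finset.mem_sups.1 he'
    obtain ⟨rfl, rfl⟩ := union_inj_of_disjoint hAB
      (Finset.mem_powerset.1 (biclique_subset_powerset _ _ ha'))
      (Finset.mem_powerset.1 (biclique_subset_powerset _ _ ha))
      (Finset.mem_powerset.1 (biclique_subset_powerset _ _ hb'))
      (Finset.mem_powerset.1 (biclique_subset_powerset _ _ hb)) hab
    obtain ⟨x, hx, y, hy, h1, h2, rfl⟩ := mem_biclique.1 ha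
    obtain ⟨z, hz, w, hw, h3, h4, rfl⟩ := mem_biclique.1 hb
    have h5 := (pair_mem_biclique.1 ha').2.2
    have h6 := (pair_mem_biclique.1 hb').2.2
    have hxy : φ x ≠ φ y := by
      intro h
      rw [h, h2] at h1
      exact absurd h1 (by decide)
    have hzw : ψ z ≠ ψ w := by
      intro h
      rw [h, h4] at h3
      exact absurd h3 (by decide)
    exact hkl ((existsUnique_separates hxy hzw).unique
      ⟨Or.inl ⟨h1, h2⟩, Or.inl ⟨h3, h4⟩⟩ ⟨h5, h6⟩)
  · intro k _
    simpa using (hasCover_biclique A _).sups hAB (biclique_subset_powerset _ _)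
      (biclique_subset_powerset _ _) (hasCover_biclique B _)

theorem exists_powersetCard_two_eq_union (q : ℕ) {A : Finset V} {N : ℕ}
    (hA : A.card ≤ q * (N + 1)) : ∃ A' ⊆ A, A'.card ≤ q * N ∧ ∃ φ : V → Fin (q + 1),
      A.powersetCard 2 = rainbowPairs A φ ∪ A'.powersetCard 2 ∧
      Disjoint (rainbowPairs A φ) (A'.powersetCard 2) := by
  obtain ⟨D, hDA, hD⟩ := Finset.exists_subset_card_eq (s := A) (n := min q A.card)
    (min_le_right _ _)
  have hDq : D.card ≤ q := hD ▸ min_le_left _ _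
  -- The removed vertices get pairwise distinct colours and everything else shares the last one, so
  -- the monochromatic pairs are exactly those avoiding `D`.
  let φ : V → Fin (q + 1) := fun v => if h : v ∈ D then
    Fin.castSucc (Fin.castLE hDq (D.equivFin ⟨v, h⟩)) else Fin.last q
  have hφD : ∀ v ∈ D, ∀ w, φ v = φ w → v = w := by
    intro v hv w h
    by_cases hw : w ∈ D
    · simpa [φ, hv, hw] using h
    · simp only [φ, hv, hw, dif_pos, dif_neg, not_false_eq_true] at h
      exact absurd h (Fin.castSucc_lt_last _).ne
  have hφ : ∀ v, v ∉ D → φ v = Fin.last q := fun v hv => by simp [φ, hv]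
  refine ⟨A \ D, Finset.sdiff_subset, ?_, φ, ?_, ?_⟩
  · rw [Finset.card_sdiff_of_subset hDA, hD]
    rw [Nat.mul_succ] at hA
    omega
  · ext e
    rw [Finset.mem_union, mem_rainbowPairs, Finset.mem_powersetCard, Finset.mem_powersetCard]
    constructor
    · rintro ⟨hs, hc⟩
      by_cases h : e ⊆ A \ D
      · exact Or.inr ⟨h, hc⟩
      · refine Or.inl ?_
        obtain ⟨v, hv, hvD⟩ := Finset.not_subset.1 h
        have hvD : v ∈ D := by
          by_contra hn
          exact hvD (Finset.mem_sdiff.2 ⟨hs hv, hn⟩)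
        obtain ⟨x, y, hxy, rfl⟩ := Finset.card_eq_two.1 hc
        refine ⟨x, hs (by simp), y, hs (by simp), fun hxy' => hxy ?_, rfl⟩
        rcases Finset.mem_insert.1 hv with rfl | hv
        · exact hφD _ hvD _ hxy'
        · rw [Finset.mem_singleton] at hv
          subst hv
          exact (hφD _ hvD _ hxy'.symm).symm
    · rintro (⟨x, hx, y, hy, hxy, rfl⟩ | ⟨hs, hc⟩)
      · exact ⟨by simp [Finset.insert_subset_iff, hx, hy],
          Finset.card_pair (by rintro rfl; exact hxy rfl)⟩
      · exact ⟨hs.trans Finset.sdiff_subset, hc⟩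
  · rw [Finset.disjoint_left]
    intro e he he'
    obtain ⟨x, hx, y, hy, hxy, rfl⟩ := mem_rainbowPairs.1 he
    have hs := (Finset.mem_powersetCard.1 he').1
    have hx' := (Finset.mem_sdiff.1 (hs (Finset.mem_insert_self x {y}))).2
    have hy' := (Finset.mem_sdiff.1 (hs (by simp : y ∈ ({x, y} : Finset V)))).2
    exact hxy ((hφ x hx').trans (hφ y hy').symm)

/-- Each round removes up to `q` vertices and pays `k` for the complete multipartite graph they span
with the rest; `N` rounds exhaust `q * N` vertices. -/
theorem hasCover_powersetCard_two_sups {q r k : ℕ} {A B : Finset V} (hAB : Disjoint A B)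
    {G : Finset (Finset V)} (hG : G ⊆ B.powerset)
    (h : ∀ A' ⊆ A, ∀ φ : V → Fin (q + 1), HasCover r (rainbowPairs A' φ ⊻ G) k) (N : ℕ) :
    ∀ A' ⊆ A, A'.card ≤ q * N → HasCover r (A'.powersetCard 2 ⊻ G) (N * k) := by
  induction N with
  | zero =>
    intro A' _ hc
    have : A' = ∅ := by simpa using hc
    subst this
    rw [Finset.powersetCard_eq_empty.2 (by simp), Finset.empty_sups]
    exact HasCover.empty r _
  | succ N ih =>
    intro A' hA' hc
    obtain ⟨A'', hsub, hc', φ, heq, hdis⟩ := exists_powersetCard_two_eq_union q hc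
    rw [heq, Finset.sups_union_left, add_comm N 1, add_mul, one_mul]
    refine HasCover.union ?_ (h A' hA' φ) (ih A'' (hsub.trans hA') hc')
    exact disjoint_sups_left (hAB.mono_left hA') (rainbowPairs_subset_powerset A' φ)
      ((powersetCard_subset_powerset 2 A'').trans (Finset.powerset_mono.2 hsub)) hG hG hdis

theorem hasCover_pairs_sups_pairs {s : ℕ} {A B : Finset V} (hAB : Disjoint A B)
    (hA : A.card ≤ s) (hB : B.card ≤ s) :
    HasCover 4 (A.powersetCard 2 ⊻ B.powersetCard 2) ((s / 3 + 1) * ((s / 5 + 1) * 14)) := by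
  refine hasCover_powersetCard_two_sups (q := 3) hAB (powersetCard_subset_powerset 2 B) ?_ _ A
    subset_rfl (by omega)
  intro A' hA' φ
  rw [Finset.sups_comm]
  refine hasCover_powersetCard_two_sups (q := 5) (hAB.mono_left hA').symm
    (rainbowPairs_subset_powerset A' φ) ?_ _ B subset_rfl (by omega)
  intro B' hB' ψ
  rw [Finset.sups_comm]
  exact hasCover_rainbowPairs_sups (hAB.mono hA' hB') φ ψ

end Pairs

/-! ### The standard cover with $\binom{n}{\lfloor r/2\rfloor}$ blocks -/

theorem sum_choose_card_filter_lt {V : Type*} [DecidableEq V] {ρ : V → ℕ} (j : ℕ)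
    (A : Finset V) (hρ : Set.InjOn ρ A) :
    ∑ y ∈ A, (A.filter fun x => ρ x < ρ y).card.choose j = A.card.choose (j + 1) := by
  induction A using Finset.induction_on_max_value ρ with
  | empty => simp
  | insert a s ha hmax ih =>
    have hlt : ∀ x ∈ s, ρ x < ρ a := fun x hx => lt_of_le_of_ne (hmax x hx) fun h =>
      ha (hρ (by simp [hx]) (by simp) h ▸ hx)
    rw [Finset.sum_insert ha, Finset.card_insert_of_notMem ha, Nat.choose_succ_succ,
      ← ih (hρ.mono (by simp))]
    congr 1
    · rw [Finset.filter_insert, if_neg (lt_irrefl _), Finset.filter_true_of_mem hlt]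
    · refine Finset.sum_congr rfl fun y hy => ?_
      rw [Finset.filter_insert, if_neg (not_lt.2 (hlt y hy).le)]

section Standard

variable {V : Type*} [DecidableEq V]

/-- The sets of `r` vertices below `y`, together with `y` and one vertex above `y`. -/
theorem powersetCard_add_two_eq_biUnion {ρ : V → ℕ} (r : ℕ) {A : Finset V}
    (hρ : Set.InjOn ρ A) : A.powersetCard (r + 2) = A.biUnion fun y =>
      (A.filter fun x => ρ x < ρ y).powersetCard r ⊻
        biclique A (fun x => if x = y then 1 else if ρ y < ρ x then 2 else 0) := by
  ext e
  simp only [Finset.mem_powersetCard, Finset.mem_biUnion, Finset.mem_sups]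
  constructor
  · rintro ⟨hs, hc⟩
    obtain ⟨z, hz, hzmax⟩ := Finset.exists_max_image e ρ (Finset.card_pos.1 (by omega))
    have hc1 : (e.erase z).card = r + 1 := by rw [Finset.card_erase_of_mem hz, hc]; rfl
    obtain ⟨y, hy, hymax⟩ := Finset.exists_max_image (e.erase z) ρ (Finset.card_pos.1 (by omega))
    have hye := Finset.mem_of_mem_erase hy
    have hyz : ρ y < ρ z := lt_of_le_of_ne (hzmax y hye) fun h =>
      Finset.ne_of_mem_erase hy (hρ (hs hye) (hs hz) h)
    refine ⟨y, hs hye, (e.erase z).erase y, ⟨?_, ?_⟩, {y, z}, pair_mem_biclique.2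
      ⟨hs hye, hs hz, ?_⟩, ?_⟩
    · intro x hx
      have hx1 := Finset.mem_of_mem_erase hx
      have hx2 := hs (Finset.mem_of_mem_erase hx1)
      exact Finset.mem_filter.2 ⟨hx2, lt_of_le_of_ne (hymax x hx1) fun h =>
        Finset.ne_of_mem_erase hx (hρ hx2 (hs hye) h)⟩
    · rw [Finset.card_erase_of_mem hy, hc1]; rfl
    · have hne : z ≠ y := by rintro rfl; exact lt_irrefl _ hyz
      exact Or.inl ⟨if_pos rfl, by rw [if_neg hne, if_pos hyz]⟩
    · ext x
      simp only [Finset.sup_eq_union, Finset.mem_union, Finset.mem_erase, Finset.mem_insert,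
        Finset.mem_singleton]
      constructor
      · rintro (h | rfl | rfl)
        · exact h.2.2
        · exact hye
        · exact hz
      · tauto
  · rintro ⟨y, hy, a, ⟨has, hac⟩, b, hb, rfl⟩
    obtain ⟨u, hu, v, hv, h1, h2, rfl⟩ := mem_biclique.1 hb
    have huy : u = y := by
      by_contra h
      simp only [if_neg h] at h1
      split_ifs at h1 <;> exact absurd h1 (by decide)
    subst huy
    have hvy : ρ u < ρ v := by
      by_contra h
      simp only [if_neg h] at h2
      split_ifs at h2 <;> exact absurd h2 (by decide)
    have hlt : ∀ x ∈ a, ρ x < ρ u := fun x hx => (Finset.mem_filter.1 (has hx)).2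
    rw [Finset.sup_eq_union]
    refine ⟨Finset.union_subset (has.trans (Finset.filter_subset _ _)) ?_, ?_⟩
    · simp [Finset.insert_subset_iff, hu, hv]
    · rw [Finset.card_union_of_disjoint, hac, Finset.card_pair]
      · rintro rfl; exact lt_irrefl _ hvy
      · rw [Finset.disjoint_left]
        intro x hx hx'
        have := hlt x hx
        simp only [Finset.mem_insert, Finset.mem_singleton] at hx'
        rcases hx' with rfl | rfl <;> omega

/-- Induction in steps of two: fix the second largest vertex `y` of an edge. The largest one ranges
over a star at `y`, the others over the sets below `y`, and the block counts add up by the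
hockey-stick identity. -/
theorem hasCover_powersetCard_of_injOn {ρ : V → ℕ} (r : ℕ) : ∀ A : Finset V, Set.InjOn ρ A →
    HasCover r (A.powersetCard r) (A.card.choose (r / 2)) := by
  induction r using Nat.strong_induction_on with
  | _ r ih =>
  intro A hρ
  match r, ih with
  | 0, _ => simpa using hasCover_singleton_empty
  | 1, _ =>
    have h := hasCover_completePartiteEdges (P := fun _ : Fin 1 => A) fun i j hij =>
      absurd (Subsingleton.elim i j) hij
    have heq : completePartiteEdges (fun _ : Fin 1 => A) = A.powersetCard 1 := by
      ext e
      simp only [completePartiteEdges, Finset.mem_filter, Finset.mem_powerset,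
        Finset.mem_powersetCard, Finset.univ_unique, Finset.singleton_biUnion]
      constructor
      · rintro ⟨hs, h⟩
        exact ⟨hs, by simpa [Finset.inter_eq_left.2 hs] using h 0⟩
      · rintro ⟨hs, h⟩
        exact ⟨hs, fun i => by rw [Finset.inter_eq_left.2 hs, h]⟩
    rw [heq] at h
    simpa using h
  | r + 2, ih =>
    have hdis : ∀ y : V, Disjoint (A.filter fun x => ρ x < ρ y) (A.filter fun x => ρ y ≤ ρ x) :=
      fun y => by
        rw [Finset.disjoint_filter]
        intro x _ h
        exact not_le.2 h
    have hsub : ∀ y ∈ A, biclique A (fun x => if x = y then 1 else if ρ y < ρ x then 2 else 0) ⊆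
        (A.filter fun x => ρ y ≤ ρ x).powerset := by
      intro y hy b hb
      obtain ⟨u, hu, v, hv, h1, h2, rfl⟩ := mem_biclique.1 hb
      have key : ∀ x, (if x = y then (1 : Fin 3) else if ρ y < ρ x then 2 else 0) ≠ 0 →
          ρ y ≤ ρ x := by
        intro x hx
        split_ifs at hx with h h'
        · exact h ▸ le_rfl
        · exact h'.le
        · exact absurd rfl hx
      simp [Finset.insert_subset_iff, hu, hv, key u (by rw [h1]; decide),
        key v (by rw [h2]; decide)]
    rw [powersetCard_add_two_eq_biUnion r hρ, show (r + 2) / 2 = r / 2 + 1 by omega,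
      ← sum_choose_card_filter_lt (r / 2) A hρ]
    refine HasCover.biUnion ?_ fun y hy => ?_
    · intro y hy y' hy' hne
      wlog hlt : ρ y < ρ y' generalizing y y'
      · exact (this y' hy' y hy hne.symm (lt_of_le_of_ne (not_lt.1 hlt) fun h =>
          hne (hρ hy' hy h).symm)).symm
      rw [Finset.disjoint_left]
      intro e he he'
      obtain ⟨a, ha, b, hb, rfl⟩ := Finset.mem_sups.1 he
      obtain ⟨a', ha', b', hb', hab⟩ := Finset.mem_sups.1 he'
      have ha := (Finset.mem_powersetCard.1 ha).1
      obtain ⟨u, hu, v, hv, h1, h2, rfl⟩ := mem_biclique.1 hb'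
      have hb1 := Finset.mem_powerset.1 (hsub y' hy' hb')
      obtain ⟨u', hu', v', hv', h1', h2', rfl⟩ := mem_biclique.1 hb
      have hv1 := (Finset.mem_filter.1 (hb1 (by simp : v ∈ ({u, v} : Finset V)))).2
      have hu1 := (Finset.mem_filter.1 (hb1 (by simp : u ∈ ({u, v} : Finset V)))).2
      have huv : u ≠ v := by
        rintro rfl
        rw [h1] at h2
        exact absurd h2 (by decide)
      have hu'y : u' = y := by
        by_contra h
        simp only [if_neg h] at h1'
        split_ifs at h1' <;> exact absurd h1' (by decide)
      -- A common edge has two vertices at or above `y'`, hence strictly above `y`; but its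
      -- decomposition at `y` has only the one vertex `v'` there.
      have key : ∀ w ∈ ({u, v} : Finset V), w = v' := by
        intro w hw
        have hw1 := (Finset.mem_filter.1 (hb1 hw)).2
        have : w ∈ a ⊔ {u', v'} := by
          rw [← hab, Finset.sup_eq_union]
          exact Finset.mem_union_right _ hw
        rw [Finset.sup_eq_union, Finset.mem_union, Finset.mem_insert, Finset.mem_singleton] at this
        rcases this with h | h | h
        · have := (Finset.mem_filter.1 (ha h)).2
          omega
        · rw [h, hu'y] at hw1
          omega
        · exact h
      exact huv ((key u (by simp)).trans (key v (by simp)).symm)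
    · have := (ih r (by omega) (A.filter fun x => ρ x < ρ y)
        (hρ.mono (Finset.coe_subset.2 (Finset.filter_subset _ _)))).sups (hdis y)
        (powersetCard_subset_powerset _ _) (hsub y hy)
        (hasCover_biclique A _)
      simpa using this

theorem hasCover_powersetCard (r : ℕ) (A : Finset V) :
    HasCover r (A.powersetCard r) (A.card.choose (r / 2)) := by
  refine hasCover_powersetCard_of_injOn
    (ρ := fun v => if h : v ∈ A then (A.equivFin ⟨v, h⟩ : ℕ) else 0) r A ?_
  intro x hx y hy h
  have hx' : x ∈ A := hx
  have hy' : y ∈ A := hy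
  simpa [hx', hy', Fin.val_inj] using h

end Standard

/-! ### Partitions of the vertex set and types of edges -/

theorem exists_fibers_card_le {V : Type*} [DecidableEq V] (s m : ℕ) : ∀ A : Finset V,
    A.card ≤ m * s → 0 < m →
      ∃ φ : V → Fin m, ∀ i, (A.filter fun v => φ v = i).card ≤ s := by
  induction m with
  | zero => intro A _ h; exact absurd h (lt_irrefl 0)
  | succ m ih =>
    intro A hA _
    rcases Nat.eq_zero_or_pos m with rfl | hm
    · exact ⟨fun _ => 0, fun i => (Finset.card_filter_le _ _).trans (by simpa using hA)⟩
    obtain ⟨D, hDA, hD⟩ := Finset.exists_subset_card_eq (s := A) (n := min s A.card)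
      (min_le_right _ _)
    obtain ⟨φ, hφ⟩ := ih (A \ D) (by
      rw [Finset.card_sdiff_of_subset hDA, hD]
      rw [Nat.succ_mul] at hA
      omega) hm
    refine ⟨fun v => if v ∈ D then Fin.last m else (φ v).castSucc, fun i => ?_⟩
    refine Fin.lastCases ?_ (fun i => ?_) i
    · refine (Finset.card_le_card (t := D) fun v hv => ?_).trans (hD ▸ min_le_left _ _)
      by_contra h
      have := (Finset.mem_filter.1 hv).2
      simp only [if_neg h] at this
      exact (Fin.castSucc_lt_last _).ne this
    · refine (Finset.card_le_card fun v hv => ?_).trans (hφ i)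
      obtain ⟨hvA, hv⟩ := Finset.mem_filter.1 hv
      by_cases h : v ∈ D
      · simp only [if_pos h] at hv
        exact absurd hv.symm (Fin.castSucc_lt_last _).ne
      · simp only [if_neg h] at hv
        exact Finset.mem_filter.2 ⟨Finset.mem_sdiff.2 ⟨hvA, h⟩, Fin.castSucc_injective _ hv⟩

section Types

variable {V ι : Type*} [DecidableEq ι]

/-- The sets of vertices with colours in `S` that contain `t i` vertices of colour `i`, for all
`i ∈ S`. -/
def setsOfType (A : Finset V) (φ : V → ι) (S : Finset ι) (t : ι → ℕ) : Finset (Finset V) :=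
  (A.filter fun v => φ v ∈ S).powerset.filter fun e =>
    ∀ i ∈ S, (e.filter fun v => φ v = i).card = t i

theorem mem_setsOfType {A : Finset V} {φ : V → ι} {S : Finset ι} {t : ι → ℕ} {e : Finset V} :
    e ∈ setsOfType A φ S t ↔ (∀ v ∈ e, v ∈ A ∧ φ v ∈ S) ∧
      ∀ i ∈ S, (e.filter fun v => φ v = i).card = t i := by
  simp [setsOfType, Finset.subset_iff]

theorem setsOfType_subset_powerset (A : Finset V) (φ : V → ι) (S : Finset ι) (t : ι → ℕ) :
    setsOfType A φ S t ⊆ (A.filter fun v => φ v ∈ S).powerset := Finset.filter_subset _ _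

theorem disjoint_filter_colours {A : Finset V} {φ : V → ι} {S S' : Finset ι}
    (h : Disjoint S S') :
    Disjoint (A.filter fun v => φ v ∈ S) (A.filter fun v => φ v ∈ S') := by
  rw [Finset.disjoint_filter]
  intro v _ hv hv'
  exact Finset.disjoint_left.1 h hv hv'

theorem setsOfType_empty (A : Finset V) (φ : V → ι) (t : ι → ℕ) :
    setsOfType A φ ∅ t = {∅} := by
  ext e
  rw [mem_setsOfType, Finset.mem_singleton, Finset.eq_empty_iff_forall_notMem]
  simp

theorem setsOfType_singleton (A : Finset V) (φ : V → ι) (i : ι) (t : ι → ℕ) :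
    setsOfType A φ {i} t = (A.filter fun v => φ v = i).powersetCard (t i) := by
  ext e
  rw [mem_setsOfType, Finset.mem_powersetCard]
  simp only [Finset.mem_singleton, forall_eq, Finset.subset_iff, Finset.mem_filter]
  refine and_congr_right fun h => ?_
  rw [Finset.filter_true_of_mem fun v hv => (h v hv).2]

theorem disjoint_setsOfType [Fintype ι] {A : Finset V} {φ : V → ι} {t t' : ι → ℕ} (h : t ≠ t') :
    Disjoint (setsOfType A φ Finset.univ t) (setsOfType A φ Finset.univ t') := by
  rw [Finset.disjoint_left]
  intro e he he'
  refine h (funext fun i => ?_)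
  rw [← (mem_setsOfType.1 he).2 i (Finset.mem_univ i),
    (mem_setsOfType.1 he').2 i (Finset.mem_univ i)]

variable [DecidableEq V]

theorem setsOfType_union {A : Finset V} {φ : V → ι} {S S' : Finset ι} (t : ι → ℕ)
    (h : Disjoint S S') :
    setsOfType A φ (S ∪ S') t = setsOfType A φ S t ⊻ setsOfType A φ S' t := by
  ext e
  rw [Finset.mem_sups]
  constructor
  · intro he
    obtain ⟨h1, h2⟩ := mem_setsOfType.1 he
    refine ⟨e.filter fun v => φ v ∈ S, mem_setsOfType.2 ⟨?_, ?_⟩,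
      e.filter fun v => φ v ∈ S', mem_setsOfType.2 ⟨?_, ?_⟩, ?_⟩
    · intro v hv
      exact ⟨(h1 v (Finset.mem_filter.1 hv).1).1, (Finset.mem_filter.1 hv).2⟩
    · intro i hi
      rw [← h2 i (Finset.mem_union_left _ hi), Finset.filter_filter]
      congr 1
      refine Finset.filter_congr fun v _ => ⟨fun h => h.2, fun h => ⟨h ▸ hi, h⟩⟩
    · intro v hv
      exact ⟨(h1 v (Finset.mem_filter.1 hv).1).1, (Finset.mem_filter.1 hv).2⟩
    · intro i hi
      rw [← h2 i (Finset.mem_union_right _ hi), Finset.filter_filter]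
      congr 1
      refine Finset.filter_congr fun v _ => ⟨fun h => h.2, fun h => ⟨h ▸ hi, h⟩⟩
    · ext v
      simp only [Finset.sup_eq_union, Finset.mem_union, Finset.mem_filter]
      constructor
      · rintro (h | h) <;> exact h.1
      · intro hv
        rcases Finset.mem_union.1 (h1 v hv).2 with h | h
        · exact Or.inl ⟨hv, h⟩
        · exact Or.inr ⟨hv, h⟩
  · rintro ⟨a, ha, b, hb, rfl⟩
    obtain ⟨ha1, ha2⟩ := mem_setsOfType.1 ha
    obtain ⟨hb1, hb2⟩ := mem_setsOfType.1 hb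
    rw [Finset.sup_eq_union]
    refine mem_setsOfType.2 ⟨?_, ?_⟩
    · intro v hv
      rcases Finset.mem_union.1 hv with hv | hv
      · exact ⟨(ha1 v hv).1, Finset.mem_union_left _ (ha1 v hv).2⟩
      · exact ⟨(hb1 v hv).1, Finset.mem_union_right _ (hb1 v hv).2⟩
    · intro i hi
      rw [Finset.filter_union]
      rcases Finset.mem_union.1 hi with hi | hi
      · rw [← ha2 i hi, Finset.filter_false_of_mem (s := b), Finset.union_empty]
        rintro v hv rfl
        exact Finset.disjoint_left.1 h hi (hb1 v hv).2
      · rw [← hb2 i hi, Finset.filter_false_of_mem (s := a), Finset.empty_union]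
        rintro v hv rfl
        exact Finset.disjoint_left.1 h (ha1 v hv).2 hi

theorem HasCover.setsOfType_union {A : Finset V} {φ : V → ι} {S S' : Finset ι} {t : ι → ℕ}
    {r r' k k' : ℕ} (h : Disjoint S S') (hS : HasCover r (setsOfType A φ S t) k)
    (hS' : HasCover r' (setsOfType A φ S' t) k') :
    HasCover (r + r') (setsOfType A φ (S ∪ S') t) (k * k') := by
  rw [_root_.setsOfType_union t h]
  exact hS.sups (disjoint_filter_colours h) (setsOfType_subset_powerset _ _ _ _)
    (setsOfType_subset_powerset _ _ _ _) hS'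

/-- Product of the standard covers of the colour classes. The halves are rounded down, so odd
entries of `t` lower the power of `s`. -/
theorem hasCover_setsOfType {A : Finset V} {φ : V → ι} {s : ℕ}
    (hs : ∀ i, (A.filter fun v => φ v = i).card ≤ s) (t : ι → ℕ) (S : Finset ι) :
    HasCover (∑ i ∈ S, t i) (setsOfType A φ S t) (s ^ ∑ i ∈ S, t i / 2) := by
  induction S using Finset.induction_on with
  | empty =>
    rw [setsOfType_empty]
    simpa using hasCover_singleton_empty
  | insert i S hi ih =>
    rw [Finset.sum_insert hi, Finset.sum_insert hi, Finset.insert_eq, pow_add]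
    refine HasCover.setsOfType_union (Finset.disjoint_singleton_left.2 hi) ?_ ih
    rw [setsOfType_singleton]
    exact (hasCover_powersetCard _ _).mono ((Nat.choose_le_pow _ _).trans
      (Nat.pow_le_pow_left (hs i) _))

/-- The number of blocks for the product of `d` complete graphs on `s` vertices. -/
def pairProductBound (s d : ℕ) : ℕ :=
  ((s / 3 + 1) * ((s / 5 + 1) * 14)) ^ (d / 2) * s ^ (d % 2)

theorem hasCover_setsOfType_two {A : Finset V} {φ : V → ι} {s : ℕ}
    (hs : ∀ i, (A.filter fun v => φ v = i).card ≤ s) (t : ι → ℕ) (d : ℕ) :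
    ∀ S : Finset ι, S.card = d → (∀ i ∈ S, t i = 2) →
      HasCover (2 * d) (setsOfType A φ S t) (pairProductBound s d) := by
  induction d using Nat.strong_induction_on with
  | _ d ih =>
  intro S hS ht
  match d, ih with
  | 0, _ =>
    rw [Finset.card_eq_zero.1 hS, setsOfType_empty]
    simpa [pairProductBound] using hasCover_singleton_empty
  | 1, _ =>
    have := hasCover_setsOfType hs t S
    have hsum : ∑ i ∈ S, t i = 2 := by rw [Finset.sum_congr rfl ht]; simp [hS]
    have hsum' : ∑ i ∈ S, t i / 2 = 1 := by
      rw [Finset.sum_congr rfl (g := fun _ => 1) fun i hi => by rw [ht i hi]]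
      simp [hS]
    rw [hsum, hsum'] at this
    simpa [pairProductBound] using this
  | d + 2, ih =>
    obtain ⟨i, T, hi, rfl, hT⟩ := Finset.card_eq_succ.1 hS
    obtain ⟨j, U, hj, rfl, hU⟩ := Finset.card_eq_succ.1 hT
    have hij : i ≠ j := by rintro rfl; exact hi (by simp)
    have hiU : i ∉ U := fun h => hi (by simp [h])
    have heq : insert i (insert j U) = ({i} ∪ {j}) ∪ U := by ext; simp
    have hpair : HasCover 4 (setsOfType A φ ({i} ∪ {j}) t)
        ((s / 3 + 1) * ((s / 5 + 1) * 14)) := by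
      rw [setsOfType_union t (Finset.disjoint_singleton.2 hij), setsOfType_singleton,
        setsOfType_singleton, ht i (by simp), ht j (by simp)]
      refine hasCover_pairs_sups_pairs ?_ (hs i) (hs j)
      rw [Finset.disjoint_filter]
      rintro v _ rfl
      exact hij
    rw [heq, show 2 * (d + 2) = 4 + 2 * d by ring, show pairProductBound s (d + 2) =
      ((s / 3 + 1) * ((s / 5 + 1) * 14)) * pairProductBound s d by
        rw [pairProductBound, pairProductBound, show (d + 2) / 2 = d / 2 + 1 by omega,
          show (d + 2) % 2 = d % 2 by omega]
        ring]
    refine hpair.setsOfType_union ?_ (ih d (by omega) U hU fun i hi => ht i (by simp [hi]))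
    rw [Finset.disjoint_left]
    intro x hx
    simp only [Finset.mem_union, Finset.mem_singleton] at hx
    rcases hx with rfl | rfl
    · exact hiU
    · exact hj

variable [Fintype ι]

theorem hasCover_setsOfType_zero_or_two {A : Finset V} {φ : V → ι} {s : ℕ}
    (hs : ∀ i, (A.filter fun v => φ v = i).card ≤ s) {d : ℕ} {S : Finset ι} (hS : S.card = d) :
    HasCover (2 * d) (setsOfType A φ Finset.univ fun i => if i ∈ S then 2 else 0)
      (pairProductBound s d) := by
  have h0 := hasCover_setsOfType hs (fun i => if i ∈ S then 2 else 0) Sᶜ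
  have h2 := hasCover_setsOfType_two hs (fun i => if i ∈ S then 2 else 0) d S hS
    fun i hi => if_pos hi
  have := h2.setsOfType_union disjoint_compl_right h0
  have e1 : ∑ i ∈ Sᶜ, (if i ∈ S then 2 else 0) = 0 :=
    Finset.sum_eq_zero fun i hi => if_neg (Finset.mem_compl.1 hi)
  have e2 : ∑ i ∈ Sᶜ, (if i ∈ S then 2 else 0) / 2 = 0 :=
    Finset.sum_eq_zero fun i hi => by simp [Finset.mem_compl.1 hi]
  rw [e1, e2, Finset.union_compl] at this
  simpa using this

theorem powersetCard_eq_biUnion_setsOfType (A : Finset V) (φ : V → ι) (r : ℕ) :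
    A.powersetCard r =
      (Finset.piAntidiag Finset.univ r).biUnion (setsOfType A φ Finset.univ) := by
  ext e
  simp only [Finset.mem_powersetCard, Finset.mem_biUnion, Finset.mem_piAntidiag, mem_setsOfType,
    Finset.mem_univ, and_true, implies_true, true_imp_iff]
  constructor
  · rintro ⟨hs, hc⟩
    refine ⟨fun i => (e.filter fun v => φ v = i).card, ?_, fun v hv => hs hv, fun _ => rfl⟩
    rw [← hc, Finset.card_eq_sum_card_fiberwise (f := φ) (t := Finset.univ) (by simp)]
  · rintro ⟨t, ht, hs, hc⟩
    refine ⟨fun v hv => hs v hv, ?_⟩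
    rw [← ht, Finset.card_eq_sum_card_fiberwise (f := φ) (t := Finset.univ) (by simp)]
    exact Finset.sum_congr rfl fun i _ => hc i

theorem card_piAntidiag_univ_eq (n : ℕ) :
    (Finset.piAntidiag (Finset.univ : Finset ι) n).card = (Fintype.card ι + n - 1).choose n := by
  rw [← Finset.map_sym_eq_piAntidiag, Finset.card_map, Finset.sym_univ, Finset.card_univ,
    Sym.card_sym_eq_choose]

theorem card_piAntidiag_univ_le (n : ℕ) :
    (Finset.piAntidiag (Finset.univ : Finset ι) n).card ≤ (n + 1) ^ Fintype.card ι := by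
  have hsub : Finset.piAntidiag (Finset.univ : Finset ι) n ⊆
      Fintype.piFinset fun _ => Finset.range (n + 1) := by
    intro t ht
    rw [Finset.mem_piAntidiag] at ht
    rw [Fintype.mem_piFinset]
    intro i
    rw [Finset.mem_range, Nat.lt_succ_iff, ← ht.1]
    exact Finset.single_le_sum (fun _ _ => Nat.zero_le _) (Finset.mem_univ i)
  exact (Finset.card_le_card hsub).trans (by simp [Finset.prod_const])

/-- A cover of the complete `2d`-graph obtained from a partition of its vertices into
`card ι` parts of size at most `s`. -/
theorem exists_hasCover_powersetCard_of_parts {A : Finset V} {φ : V → ι} {s d : ℕ}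
    (hs : ∀ i, (A.filter fun v => φ v = i).card ≤ s) (hs0 : 0 < s) :
    ∃ k, HasCover (2 * d) (A.powersetCard (2 * d)) k ∧
      k + (Fintype.card ι).choose d * s ^ d ≤
        (Fintype.card ι).choose d * pairProductBound s d +
          (Fintype.card ι + d - 1).choose d * s ^ d +
            (2 * d + 1) ^ Fintype.card ι * s ^ (d - 1) := by
  classical
  -- `T` consists of all types, `E` of those with even entries only, and `Z` of those with entries 0
  -- and 2 only.
  let T := Finset.piAntidiag (Finset.univ : Finset ι) (2 * d)
  let E := (Finset.piAntidiag (Finset.univ : Finset ι) d).image fun u i => 2 * u i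
  let Z := ((Finset.univ : Finset ι).powersetCard d).image fun S i => if i ∈ S then 2 else 0
  have hZE : Z ⊆ E := by
    intro t ht
    obtain ⟨S, hS, rfl⟩ := Finset.mem_image.1 ht
    refine Finset.mem_image.2 ⟨fun i => if i ∈ S then 1 else 0, ?_, ?_⟩
    · simpa using (Finset.mem_powersetCard.1 hS).2
    · funext i
      by_cases h : i ∈ S <;> simp [h]
  have hET : E ⊆ T := by
    intro t ht
    obtain ⟨u, hu, rfl⟩ := Finset.mem_image.1 ht
    rw [Finset.mem_piAntidiag] at hu ⊢
    exact ⟨by rw [← hu.1, Finset.mul_sum], by simp⟩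
  have hZcard : Z.card = (Fintype.card ι).choose d := by
    rw [Finset.card_image_of_injective, Finset.card_powersetCard, Finset.card_univ]
    intro S S' h
    ext i
    have := congrFun h i
    by_cases h1 : i ∈ S <;> by_cases h2 : i ∈ S' <;> simp_all
  have hEcard : E.card ≤ (Fintype.card ι + d - 1).choose d :=
    Finset.card_image_le.trans (card_piAntidiag_univ_eq d).le
  -- Outside `E` some entry is odd, so the rounded halves sum to at most `d - 1`.
  let cost : (ι → ℕ) → ℕ := fun t =>
    if t ∈ Z then pairProductBound s d else if t ∈ E then s ^ d else s ^ (d - 1)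
  refine ⟨∑ t ∈ T, cost t, ?_, ?_⟩
  · rw [powersetCard_eq_biUnion_setsOfType A φ]
    refine HasCover.biUnion (fun t _ t' _ h => disjoint_setsOfType h) fun t ht => ?_
    have htsum : ∑ i, t i = 2 * d := (Finset.mem_piAntidiag.1 ht).1
    have hcov := hasCover_setsOfType hs t Finset.univ
    rw [htsum] at hcov
    have hle : 2 * ∑ i, t i / 2 ≤ 2 * d := by
      rw [← htsum, Finset.mul_sum]
      exact Finset.sum_le_sum fun i _ => Nat.mul_div_le _ _
    simp only [cost]
    split_ifs with h1 h2
    · obtain ⟨S, hS, rfl⟩ := Finset.mem_image.1 h1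
      exact hasCover_setsOfType_zero_or_two hs (Finset.mem_powersetCard.1 hS).2
    · exact hcov.mono (Nat.pow_le_pow_right hs0 (by omega))
    · refine hcov.mono (Nat.pow_le_pow_right hs0 (Nat.le_sub_one_of_lt (lt_of_le_of_ne
        (by omega) fun h => h2 ?_)))
      refine Finset.mem_image.2 ⟨fun i => t i / 2, by simpa using h, funext fun i => ?_⟩
      have : ∀ i ∈ Finset.univ, 2 * (t i / 2) = t i := by
        refine (Finset.sum_eq_sum_iff_of_le fun i _ => Nat.mul_div_le _ _).1 ?_
        rw [← Finset.mul_sum, h, htsum]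
      exact this i (Finset.mem_univ i)
  · have h1 : ∑ t ∈ T, cost t = ∑ t ∈ Z, cost t + ∑ t ∈ E \ Z, cost t + ∑ t ∈ T \ E, cost t := by
      rw [← Finset.sum_sdiff hET, ← Finset.sum_sdiff hZE]
      ring
    have h2 : ∑ t ∈ Z, cost t = Z.card * pairProductBound s d := by
      rw [Finset.sum_congr rfl fun t ht => if_pos ht, Finset.sum_const, smul_eq_mul]
    have h3 : ∑ t ∈ E \ Z, cost t = (E \ Z).card * s ^ d := by
      rw [Finset.sum_congr rfl (g := fun _ => s ^ d), Finset.sum_const, smul_eq_mul]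
      intro t ht
      rw [Finset.mem_sdiff] at ht
      simp only [cost, if_neg ht.2, if_pos ht.1]
    have h4 : ∑ t ∈ T \ E, cost t = (T \ E).card * s ^ (d - 1) := by
      rw [Finset.sum_congr rfl (g := fun _ => s ^ (d - 1)), Finset.sum_const, smul_eq_mul]
      intro t ht
      rw [Finset.mem_sdiff] at ht
      simp only [cost, if_neg ht.2, if_neg fun h => ht.2 (hZE h)]
    have h5 : (E \ Z).card + Z.card = E.card := Finset.card_sdiff_add_card_eq_card hZE
    have h6 : (T \ E).card ≤ (2 * d + 1) ^ Fintype.card ι :=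
      (Finset.card_le_card Finset.sdiff_subset).trans (card_piAntidiag_univ_le _)
    rw [h1, h2, h3, h4, ← hZcard]
    calc Z.card * pairProductBound s d + (E \ Z).card * s ^ d + (T \ E).card * s ^ (d - 1) +
          Z.card * s ^ d
        = Z.card * pairProductBound s d + E.card * s ^ d + (T \ E).card * s ^ (d - 1) := by
          rw [← h5]; ring
      _ ≤ _ := by gcongr

end Types

/-! ### Asymptotics for even uniformity -/

theorem pairProductBound_le (s d : ℕ) :
    (pairProductBound s d : ℝ) ≤ (14 / 15 : ℝ) ^ (d / 2) * ((s : ℝ) + 5) ^ d := by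
  have h3 : ((s / 3 : ℕ) : ℝ) ≤ (s : ℝ) / 3 := by exact_mod_cast Nat.cast_div_le (α := ℝ)
  have h5 : ((s / 5 : ℕ) : ℝ) ≤ (s : ℝ) / 5 := by exact_mod_cast Nat.cast_div_le (α := ℝ)
  have hs : (0 : ℝ) ≤ s := Nat.cast_nonneg s
  have hg : (((s / 3 + 1) * ((s / 5 + 1) * 14) : ℕ) : ℝ) ≤ 14 / 15 * ((s : ℝ) + 5) ^ 2 := by
    push_cast
    have : (((s / 3 : ℕ) : ℝ) + 1) * (((s / 5 : ℕ) : ℝ) + 1) ≤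
        ((s : ℝ) / 3 + 1) * ((s : ℝ) / 5 + 1) := by gcongr
    nlinarith
  calc (pairProductBound s d : ℝ)
      = (((s / 3 + 1) * ((s / 5 + 1) * 14) : ℕ) : ℝ) ^ (d / 2) * (s : ℝ) ^ (d % 2) := by
        rw [pairProductBound]; push_cast; rfl
    _ ≤ (14 / 15 * ((s : ℝ) + 5) ^ 2) ^ (d / 2) * ((s : ℝ) + 5) ^ (d % 2) := by
        gcongr
        linarith
    _ = (14 / 15 : ℝ) ^ (d / 2) * ((s : ℝ) + 5) ^ d := by
        rw [mul_pow, mul_assoc, ← pow_mul, ← pow_add, Nat.div_add_mod]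

theorem tendsto_choose_mul_factorial_div_pow (d : ℕ) :
    Tendsto (fun m : ℕ => (m.choose d : ℝ) * d.factorial / (m : ℝ) ^ d) atTop (𝓝 1) := by
  have h0 : ∀ᶠ m : ℕ in atTop, ((m : ℝ) ^ d / d.factorial) ≠ 0 := by
    filter_upwards [eventually_gt_atTop 0] with m hm
    have : (0 : ℝ) < m := Nat.cast_pos.2 hm
    positivity
  refine ((Asymptotics.isEquivalent_iff_tendsto_one h0).1 (isEquivalent_choose d)).congr fun m => ?_
  simp only [Pi.div_apply, div_div_eq_mul_div]

theorem tendsto_choose_add_mul_factorial_div_pow (d a : ℕ) :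
    Tendsto (fun m : ℕ => ((m + a).choose d : ℝ) * d.factorial / (m : ℝ) ^ d) atTop (𝓝 1) := by
  have h1 := (tendsto_choose_mul_factorial_div_pow d).comp (tendsto_add_atTop_nat a)
  have h2 : Tendsto (fun m : ℕ => (((m + a : ℕ) : ℝ) / m) ^ d) atTop (𝓝 1) := by
    have h : Tendsto (fun m : ℕ => 1 + (a : ℝ) / m) atTop (𝓝 1) := by
      simpa using (tendsto_const_nhds (x := (1 : ℝ))).add
        (tendsto_const_div_atTop_nhds_zero_nat (a : ℝ))
    have h' := h.pow d
    rw [one_pow] at h'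
    refine h'.congr' ?_
    filter_upwards [eventually_gt_atTop 0] with m hm
    have : (m : ℝ) ≠ 0 := (Nat.cast_pos.2 hm).ne'
    congr 1
    push_cast
    field_simp
  have h3 := h1.mul h2
  rw [one_mul] at h3
  refine h3.congr' ?_
  filter_upwards [eventually_gt_atTop 0] with m hm
  have h4 : (m : ℝ) ≠ 0 := (Nat.cast_pos.2 hm).ne'
  have h5 : ((m + a : ℕ) : ℝ) ≠ 0 := Nat.cast_ne_zero.2 (by omega)
  simp only [Function.comp_apply]
  rw [div_pow]
  field_simp

/-- After division by $n^d$ the left side tends to $L/m^d$. The shift 6 is the rounding up of the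
part size (1) plus the 5 of `pairProductBound_le`. -/
theorem eventually_linear_pow_le {L K c : ℝ} {m d : ℕ} (hm : 0 < m) (hd : 0 < d)
    (hL : L / (m : ℝ) ^ d < c) : ∀ᶠ n : ℕ in atTop,
      L * ((n : ℝ) / m + 6) ^ d + K * ((n : ℝ) / m + 6) ^ (d - 1) ≤ c * (n : ℝ) ^ d := by
  obtain ⟨e, rfl⟩ : ∃ e, d = e + 1 := ⟨d - 1, by omega⟩
  have hm' : (m : ℝ) ≠ 0 := (Nat.cast_pos.2 hm).ne'
  have h1 : Tendsto (fun n : ℕ => 1 / (m : ℝ) + 6 / (n : ℝ)) atTop (𝓝 (1 / (m : ℝ))) := by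
    simpa using (tendsto_const_nhds (x := 1 / (m : ℝ))).add
      (tendsto_const_div_atTop_nhds_zero_nat (6 : ℝ))
  have h2 : Tendsto (fun n : ℕ => L * (1 / (m : ℝ) + 6 / (n : ℝ)) ^ (e + 1) +
      K * (1 / (m : ℝ) + 6 / (n : ℝ)) ^ e * (1 / (n : ℝ))) atTop
      (𝓝 (L * (1 / (m : ℝ)) ^ (e + 1) + K * (1 / (m : ℝ)) ^ e * 0)) :=
    ((h1.pow _).const_mul L).add (((h1.pow _).const_mul K).mul
      (tendsto_const_div_atTop_nhds_zero_nat (1 : ℝ)))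
  have h3 : L * (1 / (m : ℝ)) ^ (e + 1) + K * (1 / (m : ℝ)) ^ e * 0 < c := by
    rw [mul_zero, add_zero, one_div, inv_pow, ← div_eq_mul_inv]
    exact hL
  filter_upwards [h2.eventually_lt_const h3, eventually_gt_atTop 0] with n hn hn0
  have hn' : (0 : ℝ) < n := Nat.cast_pos.2 hn0
  have h4 : (n : ℝ) / m + 6 = (1 / (m : ℝ) + 6 / (n : ℝ)) * n := by
    field_simp
  rw [Nat.add_sub_cancel, h4, mul_pow, mul_pow]
  calc L * ((1 / (m : ℝ) + 6 / n) ^ (e + 1) * (n : ℝ) ^ (e + 1)) +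
        K * ((1 / (m : ℝ) + 6 / n) ^ e * (n : ℝ) ^ e)
      = (L * (1 / (m : ℝ) + 6 / n) ^ (e + 1) + K * (1 / (m : ℝ) + 6 / n) ^ e * (1 / n)) *
          (n : ℝ) ^ (e + 1) := by
        rw [pow_succ (n : ℝ) e]
        field_simp
    _ ≤ c * (n : ℝ) ^ (e + 1) := by gcongr

/-- The complete `2d`-graph on `n` vertices splits into
`((14 / 15) ^ (d / 2) + o(1)) * n ^ d / d!` blocks. -/
theorem eventually_exists_hasCover_powersetCard {d : ℕ} {c : ℝ}
    (hc : (14 / 15 : ℝ) ^ (d / 2) < c) : ∀ᶠ n : ℕ in atTop,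
      ∀ (V : Type) [DecidableEq V] (A : Finset V), A.card ≤ n →
        ∃ k, HasCover (2 * d) (A.powersetCard (2 * d)) k ∧
          (k : ℝ) ≤ c * ((n : ℝ) ^ d / d.factorial) := by
  rcases Nat.eq_zero_or_pos d with rfl | hd
  · refine Eventually.of_forall fun n V _ A hA => ⟨_, hasCover_powersetCard _ _, ?_⟩
    simp at hc ⊢
    exact hc.le
  have hfac : (0 : ℝ) < d.factorial := Nat.cast_pos.2 d.factorial_pos
  -- The number `m` of parts is fixed before `n` grows. Both normalised binomials tend to 1, so the
  -- expression tends to $(14/15)^{\lfloor d/2\rfloor}<c$.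
  obtain ⟨m, hm, hm0⟩ : ∃ m : ℕ, ((14 / 15 : ℝ) ^ (d / 2) - 1) *
      ((m.choose d : ℝ) * d.factorial / (m : ℝ) ^ d) +
        ((m + (d - 1)).choose d : ℝ) * d.factorial / (m : ℝ) ^ d < c ∧ 0 < m := by
    have h := ((tendsto_choose_mul_factorial_div_pow d).const_mul
      ((14 / 15 : ℝ) ^ (d / 2) - 1)).add (tendsto_choose_add_mul_factorial_div_pow d (d - 1))
    exact ((h.eventually_lt_const (by linarith)).and (eventually_gt_atTop 0)).exists
  have hm0' : (0 : ℝ) < m := Nat.cast_pos.2 hm0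
  set L : ℝ := (m.choose d : ℝ) * (14 / 15 : ℝ) ^ (d / 2) +
    (((m + (d - 1)).choose d : ℝ) - m.choose d) with hLdef
  have hL : L / (m : ℝ) ^ d < c / d.factorial := by
    rw [lt_div_iff₀ hfac]
    refine lt_of_eq_of_lt ?_ hm
    rw [hLdef]
    field_simp
    ring
  filter_upwards [eventually_linear_pow_le (K := (2 * d + 1 : ℝ) ^ m) hm0 hd hL] with n hn V _ A hA
  obtain ⟨φ, hφ⟩ := exists_fibers_card_le (n / m + 1) m A
    (hA.trans (by rw [Nat.mul_add, mul_one]; exact (Nat.lt_mul_div_succ n hm0).le)) hm0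
  obtain ⟨k, hk, hkle⟩ := exists_hasCover_powersetCard_of_parts (d := d) hφ (Nat.succ_pos _)
  refine ⟨k, hk, ?_⟩
  rw [Fintype.card_fin, Nat.add_sub_assoc hd] at hkle
  set s := n / m + 1
  set y : ℝ := (n : ℝ) / m + 6
  have hsy : (s : ℝ) + 5 ≤ y := by
    have : ((n / m : ℕ) : ℝ) ≤ (n : ℝ) / m := Nat.cast_div_le
    simp only [s, y]
    push_cast
    linarith
  have hs0 : (0 : ℝ) ≤ s := Nat.cast_nonneg s
  have hkle' : (k : ℝ) + m.choose d * (s : ℝ) ^ d ≤ m.choose d * (pairProductBound s d : ℝ) +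
      (m + (d - 1)).choose d * (s : ℝ) ^ d + (2 * d + 1 : ℝ) ^ m * (s : ℝ) ^ (d - 1) := by
    exact_mod_cast hkle
  have h1 : (pairProductBound s d : ℝ) ≤ (14 / 15 : ℝ) ^ (d / 2) * y ^ d :=
    (pairProductBound_le s d).trans (by gcongr)
  have h2 : ((m.choose d : ℕ) : ℝ) ≤ ((m + (d - 1)).choose d : ℕ) :=
    Nat.cast_le.2 (Nat.choose_le_choose d (Nat.le_add_right _ _))
  have hsy' : (s : ℝ) ≤ y := by linarith
  calc (k : ℝ) ≤ m.choose d * (pairProductBound s d : ℝ) +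
        (((m + (d - 1)).choose d : ℝ) - m.choose d) * (s : ℝ) ^ d +
          (2 * d + 1 : ℝ) ^ m * (s : ℝ) ^ (d - 1) := by linarith
    _ ≤ m.choose d * ((14 / 15 : ℝ) ^ (d / 2) * y ^ d) +
        (((m + (d - 1)).choose d : ℝ) - m.choose d) * y ^ d +
          (2 * d + 1 : ℝ) ^ m * y ^ (d - 1) := by
        have h3 : (0 : ℝ) ≤ ((m + (d - 1)).choose d : ℝ) - m.choose d := sub_nonneg.2 h2
        gcongr
    _ = L * y ^ d + (2 * d + 1 : ℝ) ^ m * y ^ (d - 1) := by rw [hLdef]; ring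
    _ ≤ c / d.factorial * (n : ℝ) ^ d := hn
    _ = c * ((n : ℝ) ^ d / d.factorial) := by ring

/-! ### Uniformity 125: splitting the vertex set in two -/

theorem powersetCard_union_eq_biUnion {V : Type*} [DecidableEq V] {A B : Finset V}
    (hAB : Disjoint A B) (r : ℕ) : (A ∪ B).powersetCard r =
      (Finset.range (r + 1)).biUnion fun a => A.powersetCard a ⊻ B.powersetCard (r - a) := by
  ext e
  simp only [Finset.mem_biUnion, Finset.mem_sups, Finset.mem_powersetCard, Finset.mem_range]
  constructor
  · rintro ⟨hs, hc⟩
    have heq : e ∩ A ∪ e ∩ B = e := by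
      rw [← Finset.inter_union_distrib_left, Finset.inter_eq_left.2 hs]
    have hcard : (e ∩ A).card + (e ∩ B).card = r := by
      rw [← Finset.card_union_of_disjoint (hAB.mono Finset.inter_subset_right
        Finset.inter_subset_right), heq, hc]
    exact ⟨(e ∩ A).card, by omega, e ∩ A, ⟨Finset.inter_subset_right, rfl⟩, e ∩ B,
      ⟨Finset.inter_subset_right, by omega⟩, heq⟩
  · rintro ⟨a, ha, x, ⟨hx, hxc⟩, y, ⟨hy, hyc⟩, rfl⟩
    refine ⟨Finset.union_subset_union hx hy, ?_⟩
    rw [Finset.sup_eq_union, Finset.card_union_of_disjoint (hAB.mono hx hy)]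
    omega

theorem HasCover.powersetCard_union {V : Type*} [DecidableEq V] {A B : Finset V}
    (hAB : Disjoint A B) {r : ℕ} {k l : ℕ → ℕ}
    (hA : ∀ a ≤ r, HasCover a (A.powersetCard a) (k a))
    (hB : ∀ a ≤ r, HasCover (r - a) (B.powersetCard (r - a)) (l a)) :
    HasCover r ((A ∪ B).powersetCard r) (∑ a ∈ Finset.range (r + 1), k a * l a) := by
  rw [powersetCard_union_eq_biUnion hAB]
  refine HasCover.biUnion ?_ fun a ha => ?_
  · intro a _ b _ hab
    refine disjoint_sups_left hAB (powersetCard_subset_powerset _ _)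
      (powersetCard_subset_powerset _ _) (powersetCard_subset_powerset _ _)
      (powersetCard_subset_powerset _ _) (Finset.pairwise_disjoint_powersetCard A hab)
  · have ha : a ≤ r := Nat.lt_succ_iff.1 (Finset.mem_range.1 ha)
    have := (hA a ha).sups hAB (powersetCard_subset_powerset _ _)
      (powersetCard_subset_powerset _ _) (hB a ha)
    rwa [Nat.add_sub_cancel' ha] at this

/-- Upper bound for the density of blocks in the complete `2j`-graph. -/
def evenDensity (j : ℕ) : ℚ := (14 / 15) ^ (j / 2) + 1 / 10

-- The argument of `evenDensity` is half of whichever of $a$, $125-a$ is even. The summand 1/10 in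
-- `evenDensity` absorbs the error terms and still leaves room below 0.92.
set_option maxRecDepth 100000 in
theorem sum_choose_mul_evenDensity_lt : ∑ a ∈ Finset.range 126, (Nat.choose 62 (a / 2) : ℚ) *
    evenDensity (if a % 2 = 0 then a / 2 else 62 - a / 2) < 92 / 100 * 2 ^ 62 := by
  decide +kernel

theorem eventually_minBlocks_le : ∀ᶠ h : ℕ in atTop, ∀ n ≤ 2 * h,
    (minBlocks 125 n : ℝ) ≤ 92 / 100 * (2 * h : ℝ) ^ 62 / Nat.factorial 62 := by
  have hall : ∀ᶠ h : ℕ in atTop, ∀ j ∈ Finset.range 63,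
      ∀ (V : Type) [DecidableEq V] (A : Finset V), A.card ≤ h →
        ∃ k, HasCover (2 * j) (A.powersetCard (2 * j)) k ∧
          (k : ℝ) ≤ (evenDensity j : ℝ) * ((h : ℝ) ^ j / j.factorial) := by
    refine (eventually_all_finset _).2 fun j _ => eventually_exists_hasCover_powersetCard ?_
    rw [evenDensity]
    push_cast
    linarith
  filter_upwards [hall] with h hh n hn
  obtain ⟨A, -, hA⟩ := Finset.exists_subset_card_eq (s := (Finset.univ : Finset (Fin n)))
    (n := n / 2) (by simp; omega)
  have hAh : A.card ≤ h := by omega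
  have hBh : Aᶜ.card ≤ h := by
    rw [Finset.card_compl, Fintype.card_fin]
    omega
  have key : ∀ B : Finset (Fin n), B.card ≤ h → ∀ a ≤ 125, ∃ k, HasCover a (B.powersetCard a) k ∧
      (k : ℝ) ≤ (if a % 2 = 0 then (evenDensity (a / 2) : ℝ) else 1) *
        ((h : ℝ) ^ (a / 2) / (a / 2).factorial) := by
    intro B hB a ha
    split_ifs with hpar
    · obtain ⟨k, hk⟩ := hh (a / 2) (Finset.mem_range.2 (by omega)) (Fin n) B hB
      rw [show 2 * (a / 2) = a by omega] at hk
      exact ⟨k, hk⟩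
    · refine ⟨_, hasCover_powersetCard a B, ?_⟩
      rw [one_mul]
      refine (Nat.choose_le_pow_div _ _).trans ?_
      gcongr
  choose! k hkc hk using key A hAh
  choose! l hlc hl using key Aᶜ hBh
  have hcov := HasCover.powersetCard_union (r := 125) (l := fun a => l (125 - a))
    (disjoint_compl_right (a := A)) hkc fun a _ => hlc (125 - a) (by omega)
  rw [Finset.union_compl] at hcov
  have hle : (minBlocks 125 n : ℝ) ≤ ∑ a ∈ Finset.range 126, (k a : ℝ) * l (125 - a) := by
    exact_mod_cast hcov.minBlocks_le
  have hterm : ∀ a ∈ Finset.range 126, (k a : ℝ) * l (125 - a) ≤ (Nat.choose 62 (a / 2) : ℝ) *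
      (evenDensity (if a % 2 = 0 then a / 2 else 62 - a / 2) : ℝ) *
        ((h : ℝ) ^ 62 / Nat.factorial 62) := by
    intro a ha
    rw [Finset.mem_range] at ha
    have h1 := hk a (by omega)
    have h2 := hl (125 - a) (by omega)
    rw [show (125 - a) / 2 = 62 - a / 2 by omega] at h2
    -- As 125 is odd, the two rounded halves sum to 62, so the two factorials combine into
    -- $\binom{62}{\lfloor a/2\rfloor}/62!$.
    have hch : (Nat.choose 62 (a / 2) : ℝ) = Nat.factorial 62 /
        ((a / 2).factorial * (62 - a / 2).factorial) := Nat.cast_choose ℝ (by omega)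
    have hpow : (h : ℝ) ^ 62 = (h : ℝ) ^ (a / 2) * (h : ℝ) ^ (62 - a / 2) := by
      rw [← pow_add, Nat.add_sub_cancel' (by omega)]
    have f1 : ((a / 2).factorial : ℝ) ≠ 0 := Nat.cast_ne_zero.2 (Nat.factorial_ne_zero _)
    have f2 : ((62 - a / 2).factorial : ℝ) ≠ 0 := Nat.cast_ne_zero.2 (Nat.factorial_ne_zero _)
    have f3 : (Nat.factorial 62 : ℝ) ≠ 0 := Nat.cast_ne_zero.2 (Nat.factorial_ne_zero _)
    refine (mul_le_mul h1 h2 (Nat.cast_nonneg _) ((Nat.cast_nonneg _).trans h1)).trans_eq ?_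
    rw [hch, hpow]
    generalize (Nat.factorial 62 : ℝ) = N at *
    by_cases hpar : a % 2 = 0
    · rw [if_pos hpar, if_pos hpar, if_neg (by omega)]
      field_simp
    · rw [if_neg hpar, if_neg hpar, if_pos (by omega)]
      field_simp
  have hsum : ∑ a ∈ Finset.range 126, (Nat.choose 62 (a / 2) : ℝ) *
      (evenDensity (if a % 2 = 0 then a / 2 else 62 - a / 2) : ℝ) ≤ 92 / 100 * 2 ^ 62 := by
    have := (Rat.cast_le (K := ℝ)).2 sum_choose_mul_evenDensity_lt.le
    rw [Rat.cast_sum] at this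
    simpa only [Rat.cast_mul, Rat.cast_natCast, Rat.cast_div, Rat.cast_pow, Rat.cast_ofNat]
      using this
  calc (minBlocks 125 n : ℝ) ≤ ∑ a ∈ Finset.range 126, (k a : ℝ) * l (125 - a) := hle
    _ ≤ _ := Finset.sum_le_sum hterm
    _ = (∑ a ∈ Finset.range 126, (Nat.choose 62 (a / 2) : ℝ) *
      (evenDensity (if a % 2 = 0 then a / 2 else 62 - a / 2) : ℝ)) *
        ((h : ℝ) ^ 62 / Nat.factorial 62) := by rw [Finset.sum_mul]
    _ ≤ 92 / 100 * 2 ^ 62 * ((h : ℝ) ^ 62 / Nat.factorial 62) := by gcongr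
    _ = 92 / 100 * (2 * h : ℝ) ^ 62 / Nat.factorial 62 := by rw [mul_pow]; ring

/-- With $h=\lfloor (n+1)/2\rfloor$ one has $2h\le n+1$; the gap between 0.92 and 0.96 absorbs
replacing $(n+1)^{62}/62!$ by $\binom{n}{62}$. -/
theorem eventually_minBlocks_le_mul_choose : ∀ᶠ n : ℕ in atTop,
    (minBlocks 125 n : ℝ) ≤ 96 / 100 * (n.choose 62 : ℝ) := by
  have h1 : Tendsto (fun n : ℕ => (n + 1) / 2) atTop atTop :=
    tendsto_atTop_atTop.2 fun b => ⟨2 * b, fun n hn => by omega⟩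
  have h2 := tendsto_choose_mul_factorial_div_pow 62
  have h3 : Tendsto (fun n : ℕ => 92 / 100 * (1 + 1 / (n : ℝ)) ^ 62) atTop
      (𝓝 (92 / 100 * (1 + 0) ^ 62)) :=
    ((tendsto_const_nhds.add (tendsto_const_div_atTop_nhds_zero_nat (1 : ℝ))).pow 62).const_mul _
  have h4 := h3.eventually_lt (h2.const_mul (96 / 100 : ℝ)) (by norm_num)
  filter_upwards [h1.eventually eventually_minBlocks_le, h4, eventually_gt_atTop 0] with n hn hlt hn0
  have hn' : (0 : ℝ) < n := Nat.cast_pos.2 hn0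
  have hfac : (0 : ℝ) < Nat.factorial 62 := Nat.cast_pos.2 (Nat.factorial_pos 62)
  have hhalf : 2 * (((n + 1) / 2 : ℕ) : ℝ) ≤ n + 1 := by
    exact_mod_cast Nat.mul_div_le (n + 1) 2
  generalize (Nat.factorial 62 : ℝ) = N at *
  calc (minBlocks 125 n : ℝ) ≤ 92 / 100 * (2 * (((n + 1) / 2 : ℕ) : ℝ)) ^ 62 / N :=
        hn n (by omega)
    _ ≤ 92 / 100 * ((n : ℝ) + 1) ^ 62 / N := by gcongr
    _ = 92 / 100 * (1 + 1 / (n : ℝ)) ^ 62 * ((n : ℝ) ^ 62 / N) := by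
        rw [show (n : ℝ) + 1 = (1 + 1 / (n : ℝ)) * n by field_simp, mul_pow]
        ring
    _ ≤ 96 / 100 * ((n.choose 62 : ℝ) * N / (n : ℝ) ^ 62) * ((n : ℝ) ^ 62 / N) := by gcongr
    _ = 96 / 100 * (n.choose 62 : ℝ) := by field_simp

theorem minBlocks_le_choose (r n : ℕ) : minBlocks r n ≤ n.choose (r / 2) := by
  simpa using (hasCover_powersetCard r (Finset.univ : Finset (Fin n))).minBlocks_le

theorem lemma4 :
    ∃ c : ℝ, c < 1 ∧ ∃ ε : ℕ → ℝ, Filter.Tendsto ε Filter.atTop (nhds 0) ∧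
      ∀ n : ℕ, (minBlocks 125 n : ℝ) ≤ c * (1 + ε n) * (n.choose 62 : ℝ) := by
  obtain ⟨N, hN⟩ := eventually_atTop.1 eventually_minBlocks_le_mul_choose
  -- For small `n` only the standard bound $\binom{n}{62}$ is available, and
  -- $\frac{96}{100}(1+\frac1{24})=1$.
  refine ⟨96 / 100, by norm_num, fun n => if n < N then 1 / 24 else 0, ?_, fun n => ?_⟩
  · refine tendsto_const_nhds.congr' ?_
    filter_upwards [eventually_ge_atTop N] with n hn
    rw [if_neg (not_lt.2 hn)]
  · by_cases hn : n < N
    · simp only [if_pos hn]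
      norm_num
      exact_mod_cast minBlocks_le_choose 125 n
    · simp only [if_neg hn, add_zero, mul_one]
      exact hN n (not_lt.1 hn)
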